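/- Let $L$ be a finite lattice with more than one element. A *join-irreducible* of $L$ is an element that covers exactly one element, and a *meet-irreducible* is an element that is covered by exactly one element. The *length* of $L$ is the largest $n$ such that $L$ has a chain $x_0<x_1<\dots<x_n$. The lattice $L$ is *extremal* if its length equals both the number of its join-irreducibles and the number of its meet-irreducibles. It is *semidistributive* if for all $x,y,z\in L$ $$x\vee y=x\vee z\ \Rightarrow\ x\vee(y\wedge z)=x\vee y\qquad\text{and}\qquad x\wedge y=x\wedge z\ \Rightarrow\ x\wedge(y\vee z)=x\wedge y.$$ If $L$ is extremal, every longest chain $x_0<x_1<\dots<x_n$ of $L$ gives a numbering $j_1,\dots,j_n$ of the join-irreducibles and a numbering $m_1,\dots,m_n$ of the meet-irreducibles such that $x_i=j_1\vee\dots\vee j_i=m_{i+1}\wedge\dots\wedge m_n$ for all $0\le i\le n$ (an empty join is the minimum and an empty meet is the maximum of $L$). The *Galois graph* $G(L)$ is the directed graph whose vertices are the join-irreducibles of $L$, with an edge $j_i\to j_k$ whenever $i\ne k$ and $j_i\not\le m_k$. Its *complement* $\overline{G(L)}$ is the simple undirected graph on the same vertices in which two distinct vertices are adjacent if and only if $G(L)$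 has no edge between them in either direction. The *order dimension* $\dim(L)$ is the smallest integer $n$ such that $L$ is isomorphic to a subposet of $\mathbb{R}^n$ with the componentwise order. **Theorem.** If $L$ is semidistributive and extremal, then for every longest chain used to define the Galois graph, $$\dim(L)=\chi\big(\overline{G(L)}\big),$$ where $\chi$ denotes the chromatic number. -/

import Mathlib

/-- A join-irreducible element: one that covers exactly one element. -/
def IsJoinIrr {L : Type*} [Lattice L] (j : L) : Prop := ∃! y : L, y ⋖ j

/-- A meet-irreducible element: one that is covered by exactly one element. -/
def IsMeetIrr {L : Type*} [Lattice L] (m : L) : Prop := ∃! y : L, m ⋖ y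

/-- The set of join-irreducible elements, as a type. -/
abbrev JIrr (L : Type*) [Lattice L] : Type _ := {j : L // IsJoinIrr j}

/-- The set of meet-irreducible elements, as a type. -/
abbrev MIrr (L : Type*) [Lattice L] : Type _ := {m : L // IsMeetIrr m}

/-- A (finite) lattice is extremal if its length, that is the maximum length of a chain, equals
both the number of its join-irreducibles and the number of its meet-irreducibles. -/
def IsExtremalLattice (L : Type*) [Lattice L] : Prop :=
  Order.krullDim L = ((Nat.card (JIrr L) : ℕ) : WithBot ℕ∞) ∧
    Order.krullDim L = ((Nat.card (MIrr L) : ℕ) : WithBot ℕ∞)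

/-- Join-semidistributive lattices. -/
def IsJoinSemidistributive (L : Type*) [Lattice L] : Prop :=
  ∀ x y z : L, x ⊔ y = x ⊔ z → x ⊔ (y ⊓ z) = x ⊔ y

/-- Meet-semidistributive lattices. -/
def IsMeetSemidistributive (L : Type*) [Lattice L] : Prop :=
  ∀ x y z : L, x ⊓ y = x ⊓ z → x ⊓ (y ⊔ z) = x ⊓ y

/-- Semidistributive lattices. -/
def IsSemidistributive (L : Type*) [Lattice L] : Prop :=
  IsJoinSemidistributive L ∧ IsMeetSemidistributive L

/-- A chain `c 0 < c 1 < ⋯ < c n` of maximum length. -/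
def IsLongestChain {L : Type*} [Lattice L] (c : LTSeries L) : Prop :=
  ∀ d : LTSeries L, d.length ≤ c.length

/-- The numbering of the join-irreducibles and of the meet-irreducibles along a chain
`c 0 < ⋯ < c n`: every join-irreducible is exactly one of `j 0, …, j (n-1)`, every
meet-irreducible is exactly one of `m 0, …, m (n-1)`, and for all `0 ≤ i ≤ n`
`c i = j 0 ∨ ⋯ ∨ j (i-1) = m i ∧ ⋯ ∧ m (n-1)`.
(Indices of irreducibles start at `0`; empty joins and meets are the minimum and the maximum.) -/
structure IrrNumbering {L : Type*} [Lattice L] (c : LTSeries L) where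
  /-- the numbering of the join-irreducibles -/
  j : Fin c.length ≃ JIrr L
  /-- the numbering of the meet-irreducibles -/
  m : Fin c.length ≃ MIrr L
  isLUB_j : ∀ i : Fin (c.length + 1), IsLUB {a : L | ∃ k : Fin c.length, (k : ℕ) < (i : ℕ) ∧ (j k : L) = a} (c i)
  isGLB_m : ∀ i : Fin (c.length + 1), IsGLB {a : L | ∃ k : Fin c.length, (i : ℕ) ≤ (k : ℕ) ∧ (m k : L) = a} (c i)

/-- The Galois graph: the directed graph on the join-irreducibles with an edge `j i → j k`
whenever `i ≠ k` and `j i ≰ m k`. -/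
def IrrNumbering.galoisGraph {L : Type*} [Lattice L] {c : LTSeries L} (N : IrrNumbering c) :
    Digraph (JIrr L) where
  Adj a b := ∃ i k, a = N.j i ∧ b = N.j k ∧ i ≠ k ∧ ¬ (N.j i : L) ≤ (N.m k : L)

/-- The complement of a directed graph: the simple undirected graph on the same vertices in which
two distinct vertices are adjacent if there is no directed edge between them in either direction. -/
def Digraph.undirectedCompl {V : Type*} (G : Digraph V) : SimpleGraph V where
  Adj a b := a ≠ b ∧ ¬ G.Adj a b ∧ ¬ G.Adj b a
  symm := ⟨fun _ _ h => ⟨h.1.symm, h.2.2, h.2.1⟩⟩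
  loopless := ⟨fun _ h => h.1 rfl⟩

/-- The order dimension of a poset: the smallest `n` such that the poset is isomorphic to a
subposet of `ℝⁿ` with the componentwise order (`⊤` if there is no such `n`). -/
noncomputable def orderDimension (P : Type*) [PartialOrder P] : ℕ∞ :=
  ⨅ n ∈ {n : ℕ | Nonempty (P ↪o (Fin n → ℝ))}, (n : ℕ∞)

theorem exists_isJoinIrr_le_not_le {L : Type*} [Lattice L] [Finite L] {b c : L} (h : ¬ c ≤ b) :
    ∃ a : L, IsJoinIrr a ∧ a ≤ c ∧ ¬ a ≤ b := by
  obtain ⟨a, ha⟩ := (Set.toFinite {z : L | z ≤ c ∧ ¬ z ≤ b}).exists_minimal ⟨c, le_rfl, h⟩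
  have key : ∀ y, y < a → y ≤ b := fun y hy => by
    by_contra hyb
    exact absurd (ha.le_of_le ⟨hy.le.trans ha.prop.1, hyb⟩ hy.le) (not_le_of_gt hy)
  have hmin : ¬ IsMin a := fun hm => ha.prop.2 ((hm inf_le_left).trans inf_le_right)
  obtain ⟨y, hy⟩ := exists_covBy_of_wellFoundedGT hmin
  refine ⟨a, ⟨y, hy, fun z hz => ?_⟩, ha.prop⟩
  by_contra hne
  exact ha.prop.2 ((hz.wcovBy.sup_eq hy.wcovBy hne).ge.trans (sup_le (key z hz.lt) (key y hy.lt)))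

theorem exists_isMeetIrr_le_not_le {L : Type*} [Lattice L] [Finite L] {b c : L} (h : ¬ c ≤ b) :
    ∃ a : L, IsMeetIrr a ∧ b ≤ a ∧ ¬ c ≤ a := by
  obtain ⟨a, ha⟩ := (Set.toFinite {z : L | b ≤ z ∧ ¬ c ≤ z}).exists_maximal ⟨b, le_rfl, h⟩
  have key : ∀ y, a < y → c ≤ y := fun y hy => by
    by_contra hyb
    exact absurd (ha.le_of_ge ⟨ha.prop.1.trans hy.le, hyb⟩ hy.le) (not_le_of_gt hy)
  have hmax : ¬ IsMax a := fun hm => ha.prop.2 (le_sup_right.trans (hm le_sup_left))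
  obtain ⟨y, hy⟩ := exists_covBy_of_wellFoundedLT hmax
  refine ⟨a, ⟨y, hy, fun z hz => ?_⟩, ha.prop⟩
  by_contra hne
  exact ha.prop.2 ((le_inf (key z hz.lt) (key y hy.lt)).trans (hz.wcovBy.inf_eq hy.wcovBy hne).le)

/-- Every longest chain of a finite extremal lattice gives a numbering of the irreducibles. -/
theorem IsExtremalLattice.nonempty_irrNumbering {L : Type*} [Lattice L] [Finite L]
    (hL : IsExtremalLattice L) (c : LTSeries L) (hc : IsLongestChain c) :
    Nonempty (IrrNumbering c) := by
  have hlen : Order.krullDim L = (c.length : WithBot ℕ∞) :=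
    le_antisymm (iSup_le fun d => by exact_mod_cast hc d) (le_iSup_of_le c le_rfl)
  have hJ : c.length = Nat.card (JIrr L) := by
    have := hlen.symm.trans hL.1; exact_mod_cast this
  have hM : c.length = Nat.card (MIrr L) := by
    have := hlen.symm.trans hL.2; exact_mod_cast this
  have hnle : ∀ i : Fin c.length, ¬ c i.succ ≤ c i.castSucc := fun i =>
    not_le_of_gt (c.strictMono Fin.castSucc_lt_succ)
  choose f hf1 hf2 hf3 using fun i => exists_isJoinIrr_le_not_le (hnle i)
  choose g hg1 hg2 hg3 using fun i => exists_isMeetIrr_le_not_le (hnle i)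
  have hmono : ∀ a b : Fin (c.length + 1), (a : ℕ) ≤ b → c a ≤ c b := fun a b h =>
    c.strictMono.monotone h
  have bij : ∀ {T : Type _} [Finite T] (F : Fin c.length → T), c.length = Nat.card T →
      (∀ i k, i < k → F i ≠ F k) → Function.Bijective F := by
    intro T _ F hT hF
    have hinj : Function.Injective F := fun i k hik => by
      by_contra hne
      rcases lt_or_gt_of_ne hne with h | h
      · exact hF i k h hik
      · exact hF k i h hik.symm
    exact (Nat.bijective_iff_injective_and_card F).2 ⟨hinj, by simpa using hT⟩
  have hF := bij (fun i => (⟨f i, hf1 i⟩ : JIrr L)) hJ (fun i k hik h => by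
    have h' : f i = f k := congrArg Subtype.val h
    exact hf3 k (h' ▸ (hf2 i).trans (hmono _ _ (by simp; exact hik))))
  have hG := bij (fun i => (⟨g i, hg1 i⟩ : MIrr L)) hM (fun i k hik h => by
    have h' : g i = g k := congrArg Subtype.val h
    exact hg3 i (h' ▸ (hmono i.succ k.castSucc (by simp; exact hik)).trans (hg2 k)))
  refine ⟨⟨Equiv.ofBijective _ hF, Equiv.ofBijective _ hG, fun i => ⟨?_, ?_⟩, fun i => ⟨?_, ?_⟩⟩⟩
  · rintro a ⟨k, hk, rfl⟩
    exact (hf2 k).trans (hmono _ _ (by simpa using hk))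
  · intro u hu
    by_contra hcu
    obtain ⟨a, ha, ha1, ha2⟩ := exists_isJoinIrr_le_not_le hcu
    obtain ⟨k, hk⟩ := hF.2 ⟨a, ha⟩
    have hk' : f k = a := congrArg Subtype.val hk
    by_cases hki : (k : ℕ) < i
    · exact ha2 (hu ⟨k, hki, hk'⟩)
    · exact hf3 k (hk' ▸ ha1.trans (hmono _ _ (by simpa using hki)))
  · rintro a ⟨k, hk, rfl⟩
    exact (hmono i k.castSucc (by simpa using hk)).trans (hg2 k)
  · intro u hu
    by_contra hcu
    obtain ⟨a, ha, ha1, ha2⟩ := exists_isMeetIrr_le_not_le hcu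
    obtain ⟨k, hk⟩ := hG.2 ⟨a, ha⟩
    have hk' : g k = a := congrArg Subtype.val hk
    by_cases hki : (i : ℕ) ≤ k
    · exact ha2 (hu ⟨k, hki, hk'⟩)
    · exact hg3 k (hk' ▸ (hmono k.succ i (by simp; omega)).trans ha1)

/-! For each `n`, order embeddings into `ℝⁿ` and `n`-colorings of the complement exist together.
Adjacency there means `j i ≤ m k` and `j k ≤ m i`. Given an embedding, color `j i` by a coordinate
witnessing `j i ≰ m i`; adjacent vertices cannot share one.

Conversely, semidistributivity makes `κ j`, the largest element above everything strictly below `j`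
but not above `j`, an injective map to meet-irreducibles. The chain numbering forces `κ (j i) = m
i`, so `x ≰ y` is always witnessed by some `j i ≤ x` with `y ≤ m i`. In the color of `j i`, no later
`j k` lies below `m i`, hence none below `y`: the largest index of that color separates `x` from
`y`. -/

/-- In a finite meet-semidistributive lattice, the elements whose meet with `j` is a given `p ≤ j`
have a maximum. -/
theorem IsMeetSemidistributive.exists_isGreatest_inf_eq {L : Type*} [Lattice L] [Finite L]
    (h : IsMeetSemidistributive L) {j p : L} (hp : p ≤ j) :
    ∃ m : L, IsGreatest {z : L | j ⊓ z = p} m := by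
  obtain ⟨m, hm⟩ := (Set.toFinite {z : L | j ⊓ z = p}).exists_maximal ⟨p, inf_eq_right.2 hp⟩
  refine ⟨m, hm.prop, fun w hw => ?_⟩
  -- Meet-semidistributivity closes the set under joins, so a maximal element is the maximum.
  have hmw : j ⊓ (m ⊔ w) = p := (h j m w (hm.prop.trans hw.symm)).trans hm.prop
  exact le_sup_right.trans (hm.le_of_ge hmw le_sup_left)

/-- In a finite lattice, everything strictly below a join-irreducible lies below its lower cover. -/
theorem IsJoinIrr.exists_covBy_forall_lt_le {L : Type*} [Lattice L] [Finite L] {j : L}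
    (hj : IsJoinIrr j) : ∃ p, p ⋖ j ∧ ∀ z, z < j → z ≤ p := by
  obtain ⟨p, hp, huniq⟩ := hj
  refine ⟨p, hp, fun z hz => ?_⟩
  obtain ⟨q, hzq, hq⟩ := exists_le_covBy_of_lt hz
  exact hzq.trans (huniq q hq).le

/-- In a finite meet-semidistributive lattice, every join-irreducible `j` has a meet-irreducible
`m` that is maximum among the elements above everything strictly below `j`, but not above `j`. -/
theorem IsMeetSemidistributive.exists_isMeetIrr_isGreatest {L : Type*} [Lattice L] [Finite L]
    (h : IsMeetSemidistributive L) {j : L} (hj : IsJoinIrr j) :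
    ∃ m : L, IsMeetIrr m ∧ IsGreatest {z : L | (∀ y, y < j → y ≤ z) ∧ ¬ j ≤ z} m := by
  obtain ⟨p, hp, hlt⟩ := hj.exists_covBy_forall_lt_le
  have hset : {z : L | j ⊓ z = p} = {z : L | (∀ y, y < j → y ≤ z) ∧ ¬ j ≤ z} := by
    ext z
    refine ⟨fun hz => ⟨fun y hy => (hlt y hy).trans (hz.ge.trans inf_le_right), fun hjz => ?_⟩,
      fun hz => le_antisymm (hlt _ (inf_lt_left.2 hz.2)) (le_inf hp.le (hz.1 p hp.lt))⟩
    exact hp.lt.ne (hz.symm.trans (inf_eq_left.2 hjz))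
  obtain ⟨m, hm⟩ := h.exists_isGreatest_inf_eq hp.le
  rw [hset] at hm
  have habove : ∀ w, m < w → j ≤ w := fun w hw => by
    by_contra hjw
    exact hw.not_ge (hm.2 ⟨fun y hy => (hm.1.1 y hy).trans hw.le, hjw⟩)
  have hcov : m ⋖ m ⊔ j :=
    ⟨left_lt_sup.2 hm.1.2, fun w hw hwj => hwj.not_ge (sup_le hw.le (habove w hw))⟩
  refine ⟨m, ⟨m ⊔ j, hcov, fun w hw => ?_⟩, hm⟩
  exact ((sup_le hw.le (habove w hw.lt)).eq_of_not_lt (hw.2 hcov.lt)).symm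

/-- In a join-semidistributive lattice, distinct elements cannot share an `m` that is maximal among
the elements above everything strictly below them, but not above them. -/
theorem IsJoinSemidistributive.eq_of_isGreatest {L : Type*} [Lattice L]
    (h : IsJoinSemidistributive L) {j j' m : L}
    (hm : IsGreatest {z : L | (∀ y, y < j → y ≤ z) ∧ ¬ j ≤ z} m)
    (hm' : IsGreatest {z : L | (∀ y, y < j' → y ≤ z) ∧ ¬ j' ≤ z} m) : j = j' := by
  have above : ∀ {a : L}, IsGreatest {z : L | (∀ y, y < a → y ≤ z) ∧ ¬ a ≤ z} m →
      ∀ w, m < w → a ≤ w := fun ha w hw => by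
    by_contra haw
    exact hw.not_ge (ha.2 ⟨fun y hy => (ha.1.1 y hy).trans hw.le, haw⟩)
  have heq : m ⊔ j = m ⊔ j' := le_antisymm
    (sup_le le_sup_left (above hm _ (left_lt_sup.2 hm'.1.2)))
    (sup_le le_sup_left (above hm' _ (left_lt_sup.2 hm.1.2)))
  have hinf := h m j j' heq
  -- Otherwise `hinf` would collapse `m ⊔ j` to `m`.
  have hnle : ¬ j ⊓ j' ≤ m := fun hle =>
    hm.1.2 (le_sup_right.trans (hinf.symm.trans (sup_eq_left.2 hle)).le)
  refine le_antisymm ?_ ?_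
  · by_contra hne
    exact hnle (hm.1.1 _ (inf_lt_left.2 hne))
  · by_contra hne
    exact hnle (hm'.1.1 _ (inf_lt_right.2 hne))

theorem Fin.eq_id_of_injective_of_le {n : ℕ} {f : Fin n → Fin n} (hf : Function.Injective f)
    (hle : ∀ i, f i ≤ i) (i : Fin n) : f i = i := by
  induction i using WellFoundedLT.induction with
  | ind i ih =>
    by_contra hne
    exact hne (hf (ih (f i) (lt_of_le_of_ne (hle i) hne)))

namespace IrrNumbering

variable {L : Type*} [Lattice L] {c : LTSeries L}

/-- The chain element `c k` lies between the two. -/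
theorem j_le_m_of_lt (N : IrrNumbering c) {i k : Fin c.length} (h : i < k) :
    (N.j i : L) ≤ N.m k :=
  ((N.isLUB_j k.castSucc).1 ⟨i, h, rfl⟩).trans ((N.isGLB_m k.castSucc).1 ⟨k, le_rfl, rfl⟩)

theorem not_j_le_m_self (N : IrrNumbering c) (i : Fin c.length) : ¬ (N.j i : L) ≤ N.m i := by
  intro h
  -- If `j i ≤ m i`, every `j l` with `l ≤ i` is below every `m k` with `k ≥ i`, so a chain step
  -- collapses.
  have hle : c i.succ ≤ c i.castSucc := by
    refine (N.isGLB_m i.castSucc).2 ?_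
    rintro _ ⟨k, hk, rfl⟩
    refine (N.isLUB_j i.succ).2 ?_
    rintro _ ⟨l, hl, rfl⟩
    have hli : l ≤ i := by simpa using hl
    have hik : i ≤ k := by simpa using hk
    have hlk := hli.trans hik
    rcases hlk.lt_or_eq with hlt | rfl
    · exact N.j_le_m_of_lt hlt
    · exact le_antisymm hli hik ▸ h
  exact (c.strictMono Fin.castSucc_lt_succ).not_ge hle

theorem undirectedCompl_galoisGraph_adj (N : IrrNumbering c) (i k : Fin c.length) :
    N.galoisGraph.undirectedCompl.Adj (N.j i) (N.j k) ↔
      i ≠ k ∧ (N.j i : L) ≤ N.m k ∧ (N.j k : L) ≤ N.m i := by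
  have hadj : ∀ i k, N.galoisGraph.Adj (N.j i) (N.j k) ↔ i ≠ k ∧ ¬ (N.j i : L) ≤ N.m k := by
    intro i k
    constructor
    · rintro ⟨i', k', hi, hk, h⟩
      obtain rfl := N.j.injective hi
      obtain rfl := N.j.injective hk
      exact h
    · exact fun h => ⟨i, k, rfl, rfl, h⟩
  simp only [Digraph.undirectedCompl, hadj, N.j.injective.ne_iff]
  grind

variable [Finite L]

/-- In a semidistributive lattice, the meet-irreducible `m i` is the maximum of the elements above
everything strictly below `j i`, but not above `j i`. -/
theorem isGreatest_m (N : IrrNumbering c) (h : IsSemidistributive L) (i : Fin c.length) :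
    IsGreatest {z : L | (∀ y, y < (N.j i : L) → y ≤ z) ∧ ¬ (N.j i : L) ≤ z} (N.m i) := by
  choose κ hκ hgr using fun i => h.2.exists_isMeetIrr_isGreatest (N.j i).2
  -- `σ` is `κ` read on indices. It is injective and never increases an index, so it is the
  -- identity.
  let σ : Fin c.length → Fin c.length := fun i => N.m.symm ⟨κ i, hκ i⟩
  have hσ : ∀ i, (N.m (σ i) : L) = κ i := fun i => by simp [σ]
  have hle : ∀ i, σ i ≤ i := fun i => by
    by_contra hlt
    exact (hgr i).1.2 (hσ i ▸ N.j_le_m_of_lt (not_le.1 hlt))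
  have hinj : Function.Injective σ := fun a b hab => by
    have hκab : κ a = κ b := by rw [← hσ, ← hσ, hab]
    exact N.j.injective (Subtype.ext (h.1.eq_of_isGreatest (hgr a) (hκab ▸ hgr b)))
  have hi := hσ i
  rw [Fin.eq_id_of_injective_of_le hinj hle i] at hi
  exact hi ▸ hgr i

/-- In a semidistributive lattice, the pairs `(j i, m i)` separate the elements. -/
theorem exists_j_le_le_m (N : IrrNumbering c) (h : IsSemidistributive L) {x y : L}
    (hxy : ¬ x ≤ y) : ∃ i, (N.j i : L) ≤ x ∧ y ≤ N.m i := by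
  -- By minimality of `a`, everything strictly below `a` is below `y`, so `y ≤ κ a`.
  obtain ⟨a, ha⟩ := (Set.toFinite {i : L | IsJoinIrr i ∧ i ≤ x ∧ ¬ i ≤ y}).exists_minimal
    (exists_isJoinIrr_le_not_le hxy)
  obtain ⟨i, hi⟩ := N.j.surjective ⟨a, ha.prop.1⟩
  have hia : (N.j i : L) = a := congrArg Subtype.val hi
  refine ⟨i, hia ▸ ha.prop.2.1, (N.isGreatest_m h i).2 ⟨fun z hz => ?_, hia ▸ ha.prop.2.2⟩⟩
  rw [hia] at hz
  by_contra hzy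
  obtain ⟨b, hb, hbz, hby⟩ := exists_isJoinIrr_le_not_le hzy
  have hba := hbz.trans_lt hz
  exact hba.not_ge (ha.le_of_le ⟨hb, hba.le.trans ha.prop.2.1, hby⟩ hba.le)

end IrrNumbering

/-- An embedding of the lattice into `ℝⁿ` colors the complement of the Galois graph. -/
theorem IrrNumbering.colorable_of_orderEmbedding {L : Type*} [Lattice L] {c : LTSeries L}
    (N : IrrNumbering c) {n : ℕ} (f : L ↪o (Fin n → ℝ)) :
    N.galoisGraph.undirectedCompl.Colorable n := by
  have hex : ∀ i, ∃ t, f (N.m i) t < f (N.j i) t := fun i => by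
    by_contra! hle
    exact N.not_j_le_m_self i (f.le_iff_le.1 hle)
  choose t ht using hex
  refine ⟨SimpleGraph.Coloring.mk (fun a => t (N.j.symm a)) ?_⟩
  intro a b hab heq
  obtain ⟨i, rfl⟩ := N.j.surjective a
  obtain ⟨k, rfl⟩ := N.j.surjective b
  obtain ⟨-, hik, hki⟩ := (N.undirectedCompl_galoisGraph_adj i k).1 hab
  simp only [Equiv.symm_apply_apply] at heq
  -- In the shared coordinate, `j i ≤ m k < j k ≤ m i < j i`.
  have h1 := f.monotone hik (t i)
  have h2 := f.monotone hki (t i)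
  have h3 := ht i
  have h4 := ht k
  rw [← heq] at h4
  linarith

/-- A coloring of the complement of the Galois graph of a semidistributive lattice gives an
embedding into `ℝⁿ`: the coordinate of `x` at a color is determined by the last `j i ≤ x` of that
color. -/
theorem IrrNumbering.nonempty_orderEmbedding_of_colorable {L : Type*} [Lattice L] [Finite L]
    {c : LTSeries L} (N : IrrNumbering c) (h : IsSemidistributive L) {n : ℕ}
    (hn : N.galoisGraph.undirectedCompl.Colorable n) : Nonempty (L ↪o (Fin n → ℝ)) := by
  classical
  obtain ⟨C⟩ := hn
  let s : Fin n → L → Finset (Fin c.length) := fun t x =>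
    Finset.univ.filter fun i => C (N.j i) = t ∧ (N.j i : L) ≤ x
  -- The shift by one separates index `0` from the empty supremum.
  let f : Fin n → L → ℕ := fun t x => (s t x).sup fun i => (i : ℕ) + 1
  have hmono : ∀ t, Monotone (f t) := fun t x y hxy =>
    Finset.sup_mono fun i hi => by
      simp only [s, Finset.mem_filter] at hi ⊢
      exact ⟨hi.1, hi.2.1, hi.2.2.trans hxy⟩
  have hlt : ∀ (i : Fin c.length) (x y : L), (N.j i : L) ≤ x → y ≤ N.m i → f (C (N.j i)) y < f (C (N.j i)) x := by
    intro i x y hx hy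
    have h1 : (i : ℕ) + 1 ≤ f (C (N.j i)) x :=
      Finset.le_sup (f := fun i : Fin c.length => (i : ℕ) + 1) (by simp [s, hx])
    have h2 : f (C (N.j i)) y ≤ i := Finset.sup_le fun k hk => by
      simp only [s, Finset.mem_filter] at hk
      by_contra hki
      have hik : i ≤ k := Fin.le_def.2 (by omega)
      have hkm := hk.2.2.trans hy
      rcases hik.lt_or_eq with hlt | rfl
      · exact C.valid ((N.undirectedCompl_galoisGraph_adj i k).2
          ⟨hlt.ne, N.j_le_m_of_lt hlt, hkm⟩) hk.2.1.symm
      · exact N.not_j_le_m_self i hkm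
    omega
  refine ⟨OrderEmbedding.ofMapLEIff (fun x t => (f t x : ℝ)) fun x y => ⟨fun hle => ?_,
    fun hxy t => Nat.cast_le.2 (hmono t hxy)⟩⟩
  by_contra hxy
  obtain ⟨i, hi, hi'⟩ := N.exists_j_le_le_m h hxy
  exact (hlt i x y hi hi').not_ge (Nat.cast_le.1 (hle (C (N.j i))))

theorem mainTheorem2 {L : Type*} [Lattice L] [Finite L] [Nontrivial L]
    (hsd : IsSemidistributive L) (hext : IsExtremalLattice L)
    (c : LTSeries L) (hc : IsLongestChain c) (N : IrrNumbering c) :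
    orderDimension L = N.galoisGraph.undirectedCompl.chromaticNumber := by
  have hset : {n : ℕ | Nonempty (L ↪o (Fin n → ℝ))} =
      {n : ℕ | N.galoisGraph.undirectedCompl.Colorable n} :=
    Set.ext fun n => ⟨fun ⟨f⟩ => N.colorable_of_orderEmbedding f,
      N.nonempty_orderEmbedding_of_colorable hsd⟩
  rw [orderDimension, hset, SimpleGraph.chromaticNumber]
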